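/- All monoids are commutative and cancellative and are written additively. Let $M$ be a monoid with group of invertible elements $\mathcal U(M)$. For $b,c\in M$, $b$ divides $c$ if $c=b+b'$ for some $b'\in M$; by cancellativity $b'$ is then unique and is denoted $c-b$. An atom of $M$ is an element $a\in M\setminus\mathcal U(M)$ such that $a=u+v$ with $u,v\in M$ implies $u\in\mathcal U(M)$ or $v\in\mathcal U(M)$; let $\langle\mathcal A(M)\rangle$ be the submonoid of $M$ generated by the atoms. A principal ideal of $M$ is a subset of the form $b+M$ with $b\in M$. - $M$ is *atomic* if every element of $M\setminus\mathcal U(M)$ is a sum of atoms. - $M$ *satisfies ACCP* if every ascending chain of principal ideals of $M$ eventually stabilizes; an element $b\in M$ *satisfies ACCP* if every ascending chain of principal ideals of $M$ starting at $b+M$ eventually stabilizes. - $M$ is *weak-ACCP* if $M$ is atomic and every nonempty finite subset $S$ of $M$ has a common divisor $d\in M$ such that $s-d$ satisfies ACCP for some $s\in S$. - $M$ is *strongly atomic* if all $b,c\in M$ have a common divisor $d\in\langle\mathcal A(M)\rangle$ such that every common divisor of $b-d$ and $c-d$ in $M$ is invertible. Then the following statements hold. 1. Every strongly atomic monoid is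 atomic. 2. Every weak-ACCP monoid is strongly atomic, and every monoid satisfying ACCP is weak-ACCP. 3. None of the implications ACCP $\Rightarrow$ weak-ACCP $\Rightarrow$ strongly atomic $\Rightarrow$ atomic is reversible: there is a weak-ACCP monoid that does not satisfy ACCP; there is a strongly atomic monoid that is not weak-ACCP, for instance the additive submonoid $\big\langle \frac{1}{p_np_{n+2}} \mid n\in\mathbb N\big\rangle$ of $\mathbb Q_{\ge 0}$, where $(p_n)_{n\ge 1}$ is the strictly increasing sequence of all primes; and there is an atomic monoid that is not strongly atomic. -/

import Mathlib

namespace AddFactorization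

section Definitions

variable {M : Type*} [AddCommMonoid M]

/-- Divisibility in an additively written monoid: `c = b + b'` for some `b'`. -/
def Divides (b c : M) : Prop := ∃ b' : M, c = b + b'

/-- The principal ideal `b + M`. -/
def principalIdeal (b : M) : Set M := {x | ∃ c : M, x = b + c}

/-- The subset `I` is a principal ideal of `M`. -/
def IsPrincipalIdeal (I : Set M) : Prop := ∃ b : M, I = principalIdeal b

/-- The sequence of subsets `I` is eventually constant. -/
def Stabilizes (I : ℕ → Set M) : Prop := ∃ N : ℕ, ∀ n : ℕ, N ≤ n → I n = I N

/-- The element `b` satisfies ACCP: every ascending chain of principal ideals starting at `b + M`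
eventually stabilizes. -/
def SatisfiesACCP (b : M) : Prop :=
  ∀ I : ℕ → Set M, (∀ n, IsPrincipalIdeal (I n)) → Monotone I → I 0 = principalIdeal b →
    Stabilizes I

variable (M)

/-- The submonoid `⟨𝒜(M)⟩` of all finite sums of atoms (the empty sum being `0`). -/
def atomSums : AddSubmonoid M := AddSubmonoid.closure {a : M | AddIrreducible a}

/-- The monoid is atomic: every non-invertible element is a sum of atoms. -/
def IsAtomicMonoid : Prop := ∀ b : M, ¬ IsAddUnit b → b ∈ atomSums M

/-- The monoid satisfies the ascending chain condition on principal ideals. -/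
def IsACCP : Prop :=
  ∀ I : ℕ → Set M, (∀ n, IsPrincipalIdeal (I n)) → Monotone I → Stabilizes I

/-- The monoid is weak-ACCP: it is atomic and every nonempty finite subset `S` has a common
divisor `d` such that `s - d` satisfies ACCP for some `s ∈ S`. -/
def IsWeakACCP : Prop :=
  IsAtomicMonoid M ∧
    ∀ S : Finset M, S.Nonempty →
      ∃ d : M, (∀ s ∈ S, Divides d s) ∧ ∃ s ∈ S, ∃ c : M, s = d + c ∧ SatisfiesACCP c

/-- The monoid is strongly atomic: any `b, c` have a common divisor `d ∈ ⟨𝒜(M)⟩` such that the only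
common divisors of `b - d` and `c - d` are invertible. -/
def IsStronglyAtomic : Prop :=
  ∀ b c : M, ∃ d ∈ atomSums M, ∃ b' c' : M, b = d + b' ∧ c = d + c' ∧
    ∀ e : M, Divides e b' → Divides e c' → IsAddUnit e

end Definitions

/-- The additive monoid `⟨1 / (pₙ pₙ₊₂)⟩` of rationals, where `p` enumerates all
primes increasingly (`Nat.nth Nat.Prime 0 = 2`). -/
def primeGapMonoid : AddSubmonoid ℚ :=
  AddSubmonoid.closure (Set.range fun n : ℕ =>
    1 / ((Nat.nth Nat.Prime n : ℚ) * (Nat.nth Nat.Prime (n + 2) : ℚ)))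

end AddFactorization

namespace AddFactorization

/-! ### The implications between the four conditions. -/

section General

variable {M : Type*} [AddCancelCommMonoid M]

/-! Implications. If `b` satisfies ACCP, strict divisibility is accessible below `b`, so
non-invertible common divisors of `b` and `c` can be peeled off only finitely often. What remains
has only invertible common divisors. Weak-ACCP first moves any pair to one with such an element.
Strong atomicity applied to `b, b` gives atomicity.

The first and third counterexamples adjoin to a reduced monoid `V`, for every nonzero `v`, an atom
`a` with `a + a = v`. The result (`carryMonoid`) is atomic, and each element is uniquely a base part
in `V`, its residue, plus distinct atoms. Elements of residue `0` satisfy ACCP, so divisibility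
questions reduce to `V`. For `V = ℚ≥0` the least residue of a finite set can be subtracted, giving
weak-ACCP, while `V` itself breaks ACCP. For the open quadrant with the origin, `(1, 2)` and `(2,
1)` have no maximal common divisor.

In `primeGapMonoid`, with `a n = 1 / (p n * p (n + 2))`, the two index parities hardly interact. A
sum equal to `1 / p i` uses only indices of the parity of `i`, so `1 / 2` and `1 / 3` have only the
common divisor `0`, and neither satisfies ACCP. Maximal common divisors exist nevertheless: if the
denominators of `b` and `c` avoid all primes of index at least `N`, a common divisor using a
generator of index at least `N` forces `1 / p N` or `1 / p (N + 1)` to divide both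
(`gapSum_sub_mem`). Once these are exhausted, the nonzero common divisors are bounded away from `0`.
-/

theorem divides_refl (b : M) : Divides b b := ⟨0, (add_zero b).symm⟩

theorem Divides.trans {a b c : M} (h : Divides a b) (h' : Divides b c) : Divides a c := by
  obtain ⟨x, rfl⟩ := h
  obtain ⟨y, rfl⟩ := h'
  exact ⟨x + y, add_assoc _ _ _⟩

theorem principalIdeal_subset_iff {b c : M} :
    principalIdeal b ⊆ principalIdeal c ↔ Divides c b := by
  refine ⟨fun h => h (divides_refl b), fun h x hx => ?_⟩
  exact Divides.trans h hx

/-- Strict divisibility. -/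
def StrictDivides (x y : M) : Prop := Divides x y ∧ ¬ Divides y x

theorem strictDivides_add_right {x y : M} (hy : ¬ IsAddUnit y) : StrictDivides x (x + y) := by
  refine ⟨⟨y, rfl⟩, fun ⟨z, hz⟩ => hy ?_⟩
  have h : y + z = 0 := by
    rw [add_assoc] at hz
    exact (left_eq_add.mp hz)
  exact IsAddUnit.of_add_eq_zero z h

theorem SatisfiesACCP.exists_divides_succ {x : ℕ → M} (hb : SatisfiesACCP (x 0))
    (hx : ∀ n, Divides (x (n + 1)) (x n)) : ∃ n, Divides (x n) (x (n + 1)) := by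
  obtain ⟨N, hN⟩ := hb (fun n => principalIdeal (x n)) (fun n => ⟨x n, rfl⟩)
    (monotone_nat_of_le_succ fun n => principalIdeal_subset_iff.mpr (hx n)) rfl
  exact ⟨N, principalIdeal_subset_iff.mp (hN (N + 1) (Nat.le_succ N)).subset⟩

theorem SatisfiesACCP.acc {b : M} (hb : SatisfiesACCP b) : Acc StrictDivides b := by
  by_contra h
  obtain ⟨x, rfl, hx⟩ := not_acc_iff_exists_descending_chain.mp h
  obtain ⟨n, hn⟩ := hb.exists_divides_succ fun n => (hx n).1
  exact (hx n).2 hn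

theorem IsACCP.satisfiesACCP (h : IsACCP M) (b : M) : SatisfiesACCP b :=
  fun I hI hmono _ => h I hI hmono

/-- An element satisfies ACCP as soon as its divisors carry a length function. -/
theorem satisfiesACCP_of_length {b : M} (ℓ : M → ℕ)
    (hℓ : ∀ x y, Divides (x + y) b → ℓ x ≤ ℓ (x + y) ∧ (ℓ x = ℓ (x + y) → y = 0)) :
    SatisfiesACCP b := by
  intro I hI hmono h0
  choose x hx using hI
  have hdvd : ∀ m n, m ≤ n → Divides (x n) (x m) := fun m n hmn => by
    rw [← principalIdeal_subset_iff, ← hx, ← hx]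
    exact hmono hmn
  have hb : ∀ n, Divides (x n) b := fun n => by
    rw [← principalIdeal_subset_iff, ← hx, ← h0]
    exact hmono (Nat.zero_le n)
  obtain ⟨N, hN⟩ : ∃ N, ∀ n, ℓ (x N) ≤ ℓ (x n) :=
    ⟨Function.argmin (ℓ ∘ x), fun n => Function.argmin_le (ℓ ∘ x) n⟩
  refine ⟨N, fun n hn => ?_⟩
  obtain ⟨y, hy⟩ := hdvd N n hn
  have h := hℓ (x n) y (hy ▸ hb N)
  rw [← hy] at h
  have hy0 := h.2 (le_antisymm h.1 (hN n))
  rw [hx n, hx N, hy, hy0, add_zero]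

theorem addIrreducible_add_isAddUnit {a u : M} (ha : AddIrreducible a) (hu : IsAddUnit u) :
    AddIrreducible (a + u) := by
  obtain ⟨u, rfl⟩ := hu
  refine ⟨fun h => ha.1 ?_, fun x y hxy => ?_⟩
  · exact isAddUnit_of_add_isAddUnit_left h
  · have h : a = x + (y + (-u : AddUnits M)) := by
      rw [← add_assoc, ← hxy, add_assoc, AddUnits.add_neg, add_zero]
    exact (ha.2 h).imp id fun h => isAddUnit_of_add_isAddUnit_left h

/-- A unit can be absorbed into any one atom of the sum. The first alternative covers the empty sum,
which has no atom to absorb it. -/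
theorem atomSums_add_isAddUnit {d u : M} (hd : d ∈ atomSums M) (hu : IsAddUnit u) :
    IsAddUnit d ∨ d + u ∈ atomSums M := by
  induction hd using AddSubmonoid.closure_induction with
  | mem a ha => exact Or.inr (AddSubmonoid.subset_closure (addIrreducible_add_isAddUnit ha hu))
  | zero => exact Or.inl isAddUnit_zero
  | add x y hx hy hx' hy' =>
    rcases hy' with hy' | hy'
    · rcases hx' with hx' | hx'
      · exact Or.inl (hx'.add hy')
      · right
        rw [add_right_comm]
        exact add_mem hx' hy
    · right
      rw [add_assoc]
      exact add_mem hx hy'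

theorem IsStronglyAtomic.isAtomicMonoid (h : IsStronglyAtomic M) : IsAtomicMonoid M := by
  intro b hb
  -- For the pair `b, b` the remainder is its own common divisor, hence invertible.
  obtain ⟨d, hd, b', c', hb', hc', hu⟩ := h b b
  obtain rfl : b' = c' := add_left_cancel (hb'.symm.trans hc')
  have hu' := hu b' (divides_refl _) (divides_refl _)
  rcases atomSums_add_isAddUnit hd hu' with h | h
  · exact absurd (hb' ▸ h.add hu') hb
  · exact hb' ▸ h

/-- Induction along strict divisibility: cancelling a non-invertible common divisor leaves a strict
divisor of `b`. -/
theorem exists_maximal_common_divisor_of_acc {b : M} (hb : Acc StrictDivides b) (c : M) :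
    ∃ d b' c' : M, b = d + b' ∧ c = d + c' ∧
      ∀ e : M, Divides e b' → Divides e c' → IsAddUnit e := by
  induction hb generalizing c with
  | intro b _ ih =>
    by_cases h : ∀ e : M, Divides e b → Divides e c → IsAddUnit e
    · exact ⟨0, b, c, (zero_add b).symm, (zero_add c).symm, h⟩
    · push Not at h
      obtain ⟨e, ⟨b₁, rfl⟩, ⟨c₁, rfl⟩, he⟩ := h
      obtain ⟨d, b', c', rfl, rfl, hmax⟩ :=
        ih b₁ (add_comm e b₁ ▸ strictDivides_add_right he) c₁
      exact ⟨e + d, b', c', (add_assoc _ _ _).symm, (add_assoc _ _ _).symm, hmax⟩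

theorem mem_atomSums_of_acc {b : M} (hb : Acc StrictDivides b) (hu : ¬ IsAddUnit b) :
    b ∈ atomSums M := by
  induction hb with
  | intro b _ ih =>
    by_cases h : AddIrreducible b
    · exact AddSubmonoid.subset_closure h
    · rw [addIrreducible_iff] at h
      push Not at h
      obtain ⟨x, y, rfl, hx, hy⟩ := h hu
      exact add_mem (ih x (strictDivides_add_right hy) hx)
        (ih y (add_comm y x ▸ strictDivides_add_right hx) hy)

theorem IsAtomicMonoid.isStronglyAtomic_of_maximal_common_divisor (h : IsAtomicMonoid M)
    (hmcd : ∀ b c : M, ∃ d b' c' : M, b = d + b' ∧ c = d + c' ∧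
      ∀ e : M, Divides e b' → Divides e c' → IsAddUnit e) : IsStronglyAtomic M := by
  intro b c
  obtain ⟨d, b', c', hb, hc, hmax⟩ := hmcd b c
  -- Atomicity says nothing about invertible `d`; then `0` serves equally well.
  by_cases hd : IsAddUnit d
  · refine ⟨0, zero_mem _, b, c, (zero_add b).symm, (zero_add c).symm, fun e he he' => ?_⟩
    obtain ⟨u, rfl⟩ := hd
    have key : ∀ {x x' : M}, x = u + x' → Divides e x → Divides e x' := by
      rintro x x' rfl ⟨y, hy⟩
      refine ⟨y + (-u : AddUnits M), ?_⟩
      rw [← add_assoc, ← hy, add_right_comm, AddUnits.add_neg, zero_add]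
    exact hmax e (key hb he) (key hc he')
  · exact ⟨d, h d hd, b', c', hb, hc, hmax⟩

theorem IsWeakACCP.isStronglyAtomic (h : IsWeakACCP M) : IsStronglyAtomic M := by
  classical
  refine h.1.isStronglyAtomic_of_maximal_common_divisor fun b c => ?_
  obtain ⟨d, hd, s, hs, x, hsx, hx⟩ := h.2 {b, c} (Finset.insert_nonempty _ _)
  obtain ⟨b₁, rfl⟩ := hd b (by simp)
  obtain ⟨c₁, rfl⟩ := hd c (by simp)
  rw [Finset.mem_insert, Finset.mem_singleton] at hs
  rcases hs with rfl | rfl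
  · obtain rfl := add_left_cancel hsx
    obtain ⟨e, b', c', rfl, rfl, hmax⟩ := exists_maximal_common_divisor_of_acc hx.acc c₁
    exact ⟨d + e, b', c', (add_assoc _ _ _).symm, (add_assoc _ _ _).symm, hmax⟩
  · obtain rfl := add_left_cancel hsx
    obtain ⟨e, c', b', rfl, rfl, hmax⟩ := exists_maximal_common_divisor_of_acc hx.acc b₁
    exact ⟨d + e, b', c', (add_assoc _ _ _).symm, (add_assoc _ _ _).symm,
      fun e he he' => hmax e he' he⟩

theorem IsACCP.isWeakACCP (h : IsACCP M) : IsWeakACCP M := by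
  refine ⟨fun b hb => mem_atomSums_of_acc (h.satisfiesACCP b).acc hb, fun S ⟨s, hs⟩ => ?_⟩
  exact ⟨0, fun t _ => ⟨t, (zero_add t).symm⟩, s, hs, s, (zero_add s).symm, h.satisfiesACCP s⟩

end General

instance addSubmonoidAddCancelCommMonoid {G : Type*} [AddCommGroup G] (S : AddSubmonoid G) :
    AddCancelCommMonoid S :=
  { S.toAddCommMonoid with
    add_left_cancel := fun _ _ _ h =>
      Subtype.ext (add_left_cancel (congrArg Subtype.val h)) }

end AddFactorization

namespace AddFactorization

/-! ### Adjoining halves to a reduced monoid. -/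

section CarryMonoid

variable {G ι : Type*} [AddCommGroup G]

/-- The sum of the weights `g i` over the support of `f`. -/
def weight (g : ι → G) (f : ι →₀ ZMod 2) : G := ∑ i ∈ f.support, g i

/-- Supports modulo 2 add by symmetric difference. Each index in the overlap `t` cancels and leaves
a carry `g i + g i`. -/
theorem weight_add (g : ι → G) (f h : ι →₀ ZMod 2) :
    ∃ t : Finset ι, weight g f + weight g h = weight g (f + h) + ∑ i ∈ t, (g i + g i) ∧
      (t = ∅ → (f + h).support.card = f.support.card + h.support.card) := by
  classical
  have hsupp : (f + h).support =
      (f.support \ h.support) ∪ (h.support \ f.support) := by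
    ext i
    simp only [Finsupp.mem_support_iff, Finsupp.add_apply, Finset.mem_union, Finset.mem_sdiff]
    generalize f i = a
    generalize h i = b
    revert a b
    decide
  have hdisj : Disjoint (f.support \ h.support) (h.support \ f.support) :=
    disjoint_sdiff_sdiff
  refine ⟨f.support ∩ h.support, ?_, fun ht => ?_⟩
  · have hf := Finset.sum_inter_add_sum_sdiff f.support h.support g
    have hh := Finset.sum_inter_add_sum_sdiff h.support f.support g
    rw [Finset.inter_comm] at hh
    rw [weight, weight, weight, hsupp, Finset.sum_union hdisj, Finset.sum_add_distrib, ← hf, ← hh]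
    abel
  · have hd : Disjoint f.support h.support := Finset.disjoint_iff_inter_eq_empty.mpr ht
    rw [hsupp, Finset.sdiff_eq_self_of_disjoint hd, Finset.sdiff_eq_self_of_disjoint hd.symm,
      Finset.card_union_of_disjoint hd]

/-- What remains of the first component once the weight of the second is removed. -/
def residue (g : ι → G) (x : G × (ι →₀ ZMod 2)) : G := x.1 - weight g x.2

theorem residue_add (g : ι → G) (x y : G × (ι →₀ ZMod 2)) :
    ∃ t : Finset ι, residue g (x + y) = residue g x + residue g y + ∑ i ∈ t, (g i + g i) ∧
      (t = ∅ → (x + y).2.support.card = x.2.support.card + y.2.support.card) := by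
  obtain ⟨t, ht, ht'⟩ := weight_add g x.2 y.2
  refine ⟨t, ?_, ht'⟩
  rw [residue, residue, residue, Prod.fst_add, Prod.snd_add, eq_sub_of_add_eq ht.symm]
  abel

@[simp] theorem residue_mk_zero (g : ι → G) (v : G) : residue g (v, 0) = v := by
  simp [residue, weight]

theorem residue_mk_single (g : ι → G) (i : ι) : residue g (g i, Finsupp.single i 1) = 0 := by
  simp [residue, weight]

theorem residue_sub_mk_zero (g : ι → G) (v : G) (x : G × (ι →₀ ZMod 2)) :
    residue g (x - (v, 0)) = residue g x - v := by
  simp only [residue, Prod.fst_sub, Prod.snd_sub, sub_zero]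
  abel

variable (V : AddSubmonoid G) (g : ι → G) (hg : ∀ i, g i + g i ∈ V)

/-- The monoid obtained from `V` by adjoining, for every `i`, an element `a i` with
`a i + a i = g i + g i`: it consists of the sums of an element of `V` and finitely many
distinct `a i`. The second component records which `a i` occur. -/
def carryMonoid : AddSubmonoid (G × (ι →₀ ZMod 2)) where
  carrier := {x | residue g x ∈ V}
  zero_mem' := by
    simp [residue, weight]
  add_mem' {x y} hx hy := by
    obtain ⟨t, ht, -⟩ := residue_add g x y
    rw [Set.mem_ofPred_eq, ht]
    exact add_mem (add_mem hx hy) (sum_mem fun i _ => hg i)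

variable {V g}

theorem mem_carryMonoid {x : G × (ι →₀ ZMod 2)} :
    x ∈ carryMonoid V g hg ↔ residue g x ∈ V := Iff.rfl

theorem eq_zero_of_sum_eq_zero (hV : ∀ v ∈ V, ∀ w ∈ V, v + w = 0 → v = 0)
    {ι : Type*} {s : Finset ι} {u : ι → G} (hu : ∀ i, u i ∈ V)
    (h : ∑ i ∈ s, u i = 0) : ∀ i ∈ s, u i = 0 := by
  classical
  intro i hi
  rw [← Finset.add_sum_erase s u hi] at h
  exact hV _ (hu i) _ (sum_mem fun j _ => hu j) h

/-- The residue of a sum is the two residues plus the carries. In a reduced `V` all of them vanish,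
but no single carry is zero, so the supports are disjoint. -/
theorem residue_eq_zero_of_add (hV : ∀ v ∈ V, ∀ w ∈ V, v + w = 0 → v = 0)
    (hg0 : ∀ i, g i + g i ≠ 0)
    {x y : carryMonoid V g hg}
    (h : residue g (x + y : carryMonoid V g hg).1 = 0) :
    residue g x.1 = 0 ∧ residue g y.1 = 0 ∧
      (x + y).1.2.support.card = x.1.2.support.card + y.1.2.support.card := by
  obtain ⟨t, ht, ht'⟩ := residue_add g x.1 y.1
  have hsum : ∑ i ∈ t, (g i + g i) ∈ V := sum_mem fun i _ => hg i
  rw [AddSubmonoid.coe_add, ht] at h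
  have h0 : residue g x.1 + residue g y.1 = 0 := hV _ (add_mem x.2 y.2) _ hsum h
  have hx := hV _ x.2 _ y.2 h0
  have hy := hV _ y.2 _ x.2 (by rwa [add_comm])
  refine ⟨hx, hy, ht' ?_⟩
  rw [h0, zero_add] at h
  exact Finset.eq_empty_of_forall_notMem fun i hi =>
    hg0 i (eq_zero_of_sum_eq_zero hV hg h i hi)

theorem eq_zero_of_residue_eq_zero {x : carryMonoid V g hg} (hx : residue g x.1 = 0)
    (hc : x.1.2.support.card = 0) : x = 0 := by
  have h2 : x.1.2 = 0 := by simpa using hc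
  refine Subtype.ext (Prod.ext ?_ h2)
  simpa [residue, weight, h2] using hx

theorem carryMonoid_eq_zero_of_isAddUnit (hV : ∀ v ∈ V, ∀ w ∈ V, v + w = 0 → v = 0)
    (hg0 : ∀ i, g i + g i ≠ 0)
    {x : carryMonoid V g hg} (hx : IsAddUnit x) : x = 0 := by
  obtain ⟨y, hy⟩ := hx.exists_neg
  have h := residue_eq_zero_of_add hg hV hg0 (x := x) (y := y) (by rw [hy]; simp [residue, weight])
  refine eq_zero_of_residue_eq_zero hg h.1 ?_
  have h' := h.2.2
  rw [hy] at h'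
  simp only [AddSubmonoid.coe_zero, Prod.snd_zero, Finsupp.support_zero, Finset.card_empty] at h'
  omega

/-- Every divisor of an element of residue `0` has residue `0`, and on such divisors the support
size is an additive length that vanishes only at `0`. -/
theorem carryMonoid_satisfiesACCP (hV : ∀ v ∈ V, ∀ w ∈ V, v + w = 0 → v = 0)
    (hg0 : ∀ i, g i + g i ≠ 0)
    {b : carryMonoid V g hg} (hb : residue g b.1 = 0) :
    SatisfiesACCP b := by
  refine satisfiesACCP_of_length (fun x : carryMonoid V g hg => x.1.2.support.card) ?_
  rintro x y ⟨z, rfl⟩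
  have h := residue_eq_zero_of_add hg hV hg0 (residue_eq_zero_of_add hg hV hg0 hb).1
  refine ⟨by omega, fun hxy => eq_zero_of_residue_eq_zero hg h.2.1 (by omega)⟩

/-- The adjoined element `a i`. -/
noncomputable def carryAtom (i : ι) : carryMonoid V g hg :=
  ⟨(g i, Finsupp.single i 1), by rw [mem_carryMonoid, residue_mk_single]; exact zero_mem V⟩

theorem addIrreducible_carryAtom (hV : ∀ v ∈ V, ∀ w ∈ V, v + w = 0 → v = 0)
    (hg0 : ∀ i, g i + g i ≠ 0)
    (i : ι) : AddIrreducible (carryAtom hg i) := by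
  have hcard : (carryAtom hg i).1.2.support.card = 1 := by
    simp [carryAtom]
  refine ⟨fun h => ?_, fun x y hxy => ?_⟩
  · rw [carryMonoid_eq_zero_of_isAddUnit hg hV hg0 h] at hcard
    simp at hcard
  · have h := residue_eq_zero_of_add hg hV hg0 (x := x) (y := y)
      (by rw [← hxy]; exact residue_mk_single g i)
    rw [← hxy, hcard] at h
    rcases Nat.eq_zero_or_pos x.1.2.support.card with hx | hx
    · left
      rw [eq_zero_of_residue_eq_zero hg h.1 hx]
      exact isAddUnit_zero
    · right
      rw [eq_zero_of_residue_eq_zero hg h.2.1 (by omega)]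
      exact isAddUnit_zero

/-- The copy of `V` inside `carryMonoid V g hg`. -/
def carryBase (v : V) : carryMonoid V g hg :=
  ⟨(v, 0), by rw [mem_carryMonoid, residue_mk_zero]; exact v.2⟩

theorem carryAtom_add_self (i : ι) :
    carryAtom hg i + carryAtom hg i = carryBase hg ⟨g i + g i, hg i⟩ := by
  refine Subtype.ext (Prod.ext rfl ?_)
  change Finsupp.single i (1 : ZMod 2) + Finsupp.single i 1 = 0
  rw [← Finsupp.single_add, show (1 + 1 : ZMod 2) = 0 by decide, Finsupp.single_zero]

theorem carryBase_divides {v : V} {x : carryMonoid V g hg} (h : residue g x.1 - v ∈ V) :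
    ∃ y, x = carryBase hg v + y ∧ residue g y.1 = residue g x.1 - v := by
  refine ⟨⟨x.1 - (v.1, 0), ?_⟩, ?_, residue_sub_mk_zero g v.1 x.1⟩
  · rwa [mem_carryMonoid, residue_sub_mk_zero]
  · exact Subtype.ext (add_sub_cancel _ _).symm

theorem carryMonoid_isAtomicMonoid (hV : ∀ v ∈ V, ∀ w ∈ V, v + w = 0 → v = 0)
    (hg0 : ∀ i, g i + g i ≠ 0)
    (hsurj : ∀ v ∈ V, v ≠ 0 → ∃ i, g i + g i = v) :
    IsAtomicMonoid (carryMonoid V g hg) := by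
  have hatom : ∀ i, carryAtom hg i ∈ atomSums (carryMonoid V g hg) := fun i =>
    AddSubmonoid.subset_closure (addIrreducible_carryAtom hg hV hg0 i)
  have hbase : ∀ v : V, carryBase hg v ∈ atomSums (carryMonoid V g hg) := by
    rintro ⟨v, hv⟩
    by_cases h0 : v = 0
    · subst h0
      exact zero_mem _
    · obtain ⟨i, rfl⟩ := hsurj v hv h0
      rw [← carryAtom_add_self]
      exact add_mem (hatom i) (hatom i)
  have hsum : ∀ f : ι →₀ ZMod 2, ∃ y ∈ atomSums (carryMonoid V g hg), y.1 = (weight g f, f) := by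
    intro f
    refine ⟨∑ i ∈ f.support, carryAtom hg i, sum_mem fun i _ => hatom i, ?_⟩
    rw [AddSubmonoid.coe_finsetSum]
    refine Prod.ext ?_ ?_
    · rw [Prod.fst_sum]
      rfl
    · rw [Prod.snd_sum]
      have : f = ∑ i ∈ f.support, Finsupp.single i (f i) := f.sum_single.symm
      conv_rhs => rw [this]
      refine Finset.sum_congr rfl fun i hi => ?_
      have h1 : ∀ a : ZMod 2, a ≠ 0 → a = 1 := by decide
      rw [h1 (f i) (Finsupp.mem_support_iff.mp hi)]
      rfl
  intro b _
  -- Split `b` into its residue, which is zero or twice an atom, and the distinct atoms recorded by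
  -- its second component.
  obtain ⟨y, hy, hyb⟩ := hsum b.1.2
  have hb : b = carryBase hg ⟨residue g b.1, b.2⟩ + y := by
    refine Subtype.ext ?_
    rw [AddSubmonoid.coe_add, hyb]
    exact Prod.ext (sub_add_cancel _ _).symm (zero_add _).symm
  rw [hb]
  exact add_mem (hbase _) hy

end CarryMonoid

section HalfCarryMonoid

variable {G : Type*} [AddCommGroup G] [Module ℚ G] (V : AddSubmonoid G)

/-- Half of a nonzero element of `V`. -/
def half (v : {v : G // v ∈ V ∧ v ≠ 0}) : G := (1 / 2 : ℚ) • v.1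

theorem half_add_half (v : {v : G // v ∈ V ∧ v ≠ 0}) : half V v + half V v = v.1 := by
  rw [half, ← add_smul]
  norm_num

theorem half_add_half_mem (v : {v : G // v ∈ V ∧ v ≠ 0}) : half V v + half V v ∈ V :=
  half_add_half V v ▸ v.2.1

theorem half_add_half_ne_zero (v : {v : G // v ∈ V ∧ v ≠ 0}) : half V v + half V v ≠ 0 :=
  half_add_half V v ▸ v.2.2

/-- The monoid `V` with a half of each of its nonzero elements adjoined. -/
abbrev halfCarryMonoid : AddSubmonoid (G × ({v : G // v ∈ V ∧ v ≠ 0} →₀ ZMod 2)) :=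
  carryMonoid V (half V) (half_add_half_mem V)

theorem halfCarryMonoid_isAtomicMonoid (hV : ∀ v ∈ V, ∀ w ∈ V, v + w = 0 → v = 0) :
    IsAtomicMonoid (halfCarryMonoid V) :=
  carryMonoid_isAtomicMonoid _ hV (half_add_half_ne_zero V)
    fun v hv h0 => ⟨⟨v, hv, h0⟩, half_add_half V _⟩

end HalfCarryMonoid

/-! ### A weak-ACCP monoid without ACCP. -/

section NonnegRat

/-- The nonnegative rationals. -/
def nonnegRat : AddSubmonoid ℚ := AddSubmonoid.nonneg ℚ

theorem nonnegRat_reduced : ∀ v ∈ nonnegRat, ∀ w ∈ nonnegRat, v + w = 0 → v = 0 :=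
  fun _ hv _ hw h => ((add_eq_zero_iff_of_nonneg hv hw).mp h).1

theorem isWeakACCP_halfCarryMonoid_nonnegRat : IsWeakACCP (halfCarryMonoid nonnegRat) := by
  refine ⟨halfCarryMonoid_isAtomicMonoid _ nonnegRat_reduced, fun S hS => ?_⟩
  obtain ⟨s, hs, hmin⟩ := S.exists_min_image (fun x => residue (half nonnegRat) x.1) hS
  let hg := half_add_half_mem nonnegRat
  have key : ∀ t ∈ S, ∃ y, t = carryBase hg ⟨residue (half nonnegRat) s.1, s.2⟩ + y ∧
      residue (half nonnegRat) y.1 =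
        residue (half nonnegRat) t.1 - residue (half nonnegRat) s.1 :=
    fun t ht => carryBase_divides hg (v := ⟨_, s.2⟩) (x := t) (sub_nonneg.mpr (hmin t ht))
  refine ⟨carryBase hg ⟨residue (half nonnegRat) s.1, s.2⟩, fun t ht => ?_, s, hs, ?_⟩
  · obtain ⟨y, hy, -⟩ := key t ht
    exact ⟨y, hy⟩
  · obtain ⟨y, hy, hy0⟩ := key s hs
    exact ⟨y, hy, carryMonoid_satisfiesACCP hg nonnegRat_reduced (half_add_half_ne_zero _)
      (hy0.trans (sub_self _))⟩

theorem not_isACCP_halfCarryMonoid_nonnegRat : ¬ IsACCP (halfCarryMonoid nonnegRat) := by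
  intro h
  let hg := half_add_half_mem nonnegRat
  let x : ℕ → halfCarryMonoid nonnegRat := fun n =>
    carryBase hg ⟨1 / ((n : ℚ) + 1), by
      change (0 : ℚ) ≤ _
      positivity⟩
  obtain ⟨n, y, hy⟩ := (h.satisfiesACCP (x 0)).exists_divides_succ (x := x) fun n => by
    obtain ⟨y, hy, -⟩ := carryBase_divides hg (v := ⟨1 / (((n + 1 : ℕ) : ℚ) + 1), by
      change (0 : ℚ) ≤ _
      positivity⟩) (x := x n) (by
        change (0 : ℚ) ≤ residue _ (_, 0) - _
        rw [residue_mk_zero, sub_nonneg]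
        push_cast
        exact one_div_le_one_div_of_le (by positivity) (by linarith))
    exact ⟨y, hy⟩
  have h1 : 1 / (((n + 1 : ℕ) : ℚ) + 1) = 1 / ((n : ℚ) + 1) + y.1.1 :=
    congrArg (fun z => z.1.1) hy
  have h2 : (0 : {v : ℚ // v ∈ nonnegRat ∧ v ≠ 0} →₀ ZMod 2) = 0 + y.1.2 :=
    congrArg (fun z => z.1.2) hy
  have h3 : 0 ≤ residue (half nonnegRat) y.1 := y.2
  rw [zero_add] at h2
  rw [residue, ← h2] at h3
  simp only [weight, Finsupp.support_zero, Finset.sum_empty, sub_zero] at h3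
  have h4 : 1 / (((n + 1 : ℕ) : ℚ) + 1) < 1 / ((n : ℚ) + 1) :=
    one_div_lt_one_div_of_lt (by positivity) (by push_cast; linarith)
  linarith

end NonnegRat

/-! ### An atomic monoid that is not strongly atomic. -/

section OpenQuadrant

/-- The origin together with the open positive quadrant of the rational plane. -/
def openQuadrant : AddSubmonoid (ℚ × ℚ) where
  carrier := {v | v = 0 ∨ (0 < v.1 ∧ 0 < v.2)}
  zero_mem' := Or.inl rfl
  add_mem' {v w} hv hw := by
    rcases hv with rfl | hv
    · rwa [zero_add]
    · rcases hw with rfl | hw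
      · rw [add_zero]
        exact Or.inr hv
      · exact Or.inr ⟨add_pos hv.1 hw.1, add_pos hv.2 hw.2⟩

theorem mem_openQuadrant {v : ℚ × ℚ} : v ∈ openQuadrant ↔ v = 0 ∨ (0 < v.1 ∧ 0 < v.2) := Iff.rfl

theorem openQuadrant_reduced : ∀ v ∈ openQuadrant, ∀ w ∈ openQuadrant, v + w = 0 → v = 0 := by
  intro v hv w hw h
  rcases hv with hv | hv
  · exact hv
  · have h1 : v.1 + w.1 = 0 := congrArg Prod.fst h
    rcases hw with rfl | hw
    · simpa using h
    · linarith [hv.1, hw.1]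

theorem exists_openQuadrant_lt {v w : ℚ × ℚ} (hv : 0 < v.1 ∧ 0 < v.2) (hw : 0 < w.1 ∧ 0 < w.2) :
    ∃ e ∈ openQuadrant, e ≠ 0 ∧ v - e ∈ openQuadrant ∧ w - e ∈ openQuadrant := by
  obtain ⟨x, hx, hx'⟩ := exists_between (lt_min hv.1 hw.1)
  obtain ⟨y, hy, hy'⟩ := exists_between (lt_min hv.2 hw.2)
  rw [lt_min_iff] at hx' hy'
  refine ⟨(x, y), Or.inr ⟨hx, hy⟩, fun h => hx.ne' (congrArg Prod.fst h), Or.inr ?_, Or.inr ?_⟩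
  · exact ⟨sub_pos.mpr hx'.1, sub_pos.mpr hy'.1⟩
  · exact ⟨sub_pos.mpr hx'.2, sub_pos.mpr hy'.2⟩

theorem not_isStronglyAtomic_halfCarryMonoid_openQuadrant :
    ¬ IsStronglyAtomic (halfCarryMonoid openQuadrant) := by
  intro h
  let hg := half_add_half_mem openQuadrant
  obtain ⟨d, -, b', c', hb, hc, hmax⟩ := h
    (carryBase hg ⟨(1, 2), Or.inr ⟨by norm_num, by norm_num⟩⟩)
    (carryBase hg ⟨(2, 1), Or.inr ⟨by norm_num, by norm_num⟩⟩)
  have hb1 : ((1, 2) : ℚ × ℚ) = d.1.1 + b'.1.1 := congrArg (fun z => z.1.1) hb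
  have hc1 : ((2, 1) : ℚ × ℚ) = d.1.1 + c'.1.1 := congrArg (fun z => z.1.1) hc
  have h2 : d.1.2 + b'.1.2 = d.1.2 + c'.1.2 :=
    (congrArg (fun z => z.1.2) hb).symm.trans (congrArg (fun z => z.1.2) hc)
  -- The remainders have the same second component, so their residues differ by `(2, 1) - (1, 2)`.
  -- Neither `(1, -1)` nor its negative lies in the quadrant, so both residues are nonzero and share
  -- a smaller nonzero divisor.
  have hdiff : residue (half openQuadrant) c'.1 - residue (half openQuadrant) b'.1 = (1, -1) := by
    rw [residue, residue, add_left_cancel h2, sub_sub_sub_cancel_right,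
      ← add_sub_add_left_eq_sub _ _ d.1.1, ← hb1, ← hc1]
    norm_num
  have hd1 := congrArg Prod.fst hdiff
  have hd2 := congrArg Prod.snd hdiff
  simp only [Prod.fst_sub, Prod.snd_sub] at hd1 hd2
  have hb' := mem_openQuadrant.mp b'.2
  have hc' := mem_openQuadrant.mp c'.2
  rcases hb' with hb' | hb'
  · rw [hb'] at hd1 hd2
    rcases hc' with hc' | hc'
    · rw [hc'] at hd1
      norm_num at hd1
    · have := hc'.2
      simp only [Prod.snd_zero, sub_zero] at hd2
      linarith
  · rcases hc' with hc' | hc'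
    · rw [hc'] at hd1
      have := hb'.1
      simp only [Prod.fst_zero, zero_sub] at hd1
      linarith
    · obtain ⟨e, he, he0, heb, hec⟩ := exists_openQuadrant_lt hb' hc'
      obtain ⟨y, hy, -⟩ := carryBase_divides hg (v := ⟨e, he⟩) heb
      obtain ⟨z, hz, -⟩ := carryBase_divides hg (v := ⟨e, he⟩) hec
      have h0 := carryMonoid_eq_zero_of_isAddUnit hg openQuadrant_reduced
        (half_add_half_ne_zero _) (hmax _ ⟨y, hy⟩ ⟨z, hz⟩)
      exact he0 (congrArg (fun z => z.1.1) h0)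

end OpenQuadrant

end AddFactorization

namespace AddFactorization

/-! ### The prime gap monoid: local integrality, generators and atoms. -/

section PrimeGapMonoid

/-- The increasing enumeration of the primes, with `nthPrime 0 = 2`. -/
noncomputable abbrev nthPrime (n : ℕ) : ℕ := Nat.nth Nat.Prime n

theorem nthPrime_prime (n : ℕ) : (nthPrime n).Prime := Nat.prime_nth_prime n

theorem nthPrime_pos (n : ℕ) : (0 : ℚ) < nthPrime n := by
  exact_mod_cast (nthPrime_prime n).pos

theorem nthPrime_strictMono : StrictMono nthPrime :=
  Nat.nth_strictMono Nat.infinite_setOfPred_prime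

theorem nthPrime_dvd_nthPrime_iff {m n : ℕ} : nthPrime m ∣ nthPrime n ↔ m = n := by
  rw [Nat.prime_dvd_prime_iff_eq (nthPrime_prime m) (nthPrime_prime n),
    nthPrime_strictMono.injective.eq_iff]

/-- The rationals whose denominator is not divisible by the prime `nthPrime n`. -/
def integralAt (n : ℕ) : AddSubgroup ℚ where
  carrier := {z | ¬ nthPrime n ∣ z.den}
  zero_mem' := by simpa using (nthPrime_prime n).ne_one
  add_mem' {x y} hx hy h :=
    ((nthPrime_prime n).dvd_mul.mp (h.trans (Rat.add_den_dvd x y))).elim hx hy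
  neg_mem' {x} hx := by simpa using hx

theorem mem_integralAt {n : ℕ} {z : ℚ} : z ∈ integralAt n ↔ ¬ nthPrime n ∣ z.den := Iff.rfl

theorem one_div_mem_integralAt {n m : ℕ} (h : ¬ nthPrime n ∣ m) : (1 / m : ℚ) ∈ integralAt n := by
  rw [mem_integralAt, one_div, Rat.inv_natCast_den_of_pos]
  · exact h
  · exact Nat.pos_of_ne_zero fun h0 => h (h0 ▸ dvd_zero _)

theorem dvd_of_div_mem_integralAt {n t : ℕ} (h : (t / nthPrime n : ℚ) ∈ integralAt n) :
    nthPrime n ∣ t := by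
  have h1 : ((t * (t / nthPrime n : ℚ).den : ℕ) : ℤ) =
      (t / nthPrime n : ℚ).num * (nthPrime n : ℕ) := by
    have h2 := Rat.mul_den_eq_num (t / nthPrime n : ℚ)
    have h3 := (nthPrime_pos n).ne'
    have h4 : ((t * (t / nthPrime n : ℚ).den : ℕ) : ℚ) =
        (t / nthPrime n : ℚ).num * (nthPrime n : ℕ) := by
      rw [← h2]
      push_cast
      field_simp
    exact_mod_cast h4
  have h5 : nthPrime n ∣ t * (t / nthPrime n : ℚ).den := by
    rw [← Int.natCast_dvd_natCast, h1]
    exact dvd_mul_left _ _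
  exact ((nthPrime_prime n).dvd_mul.mp h5).resolve_right h

theorem exists_forall_mem_integralAt (z : ℚ) : ∃ N, ∀ n, N ≤ n → z ∈ integralAt n := by
  refine ⟨z.den, fun n hn h => ?_⟩
  have h1 := Nat.le_of_dvd z.den_pos h
  have h2 : n + 2 ≤ nthPrime n := Nat.add_two_le_nth_prime n
  omega

theorem den_eq_one_of_forall_mem_integralAt {z : ℚ} (h : ∀ n, z ∈ integralAt n) : z.den = 1 := by
  by_contra h1
  obtain ⟨q, hq, hqz⟩ := Nat.exists_prime_and_dvd h1
  apply h (Nat.count Nat.Prime q)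
  rwa [nthPrime, Nat.nth_count hq]

/-- The generators of `primeGapMonoid`. -/
noncomputable def gapAtom (n : ℕ) : ℚ := 1 / ((nthPrime n : ℚ) * (nthPrime (n + 2) : ℚ))

theorem gapAtom_pos (n : ℕ) : 0 < gapAtom n :=
  one_div_pos.mpr (mul_pos (nthPrime_pos n) (nthPrime_pos (n + 2)))

theorem gapAtom_strictAnti : StrictAnti gapAtom := by
  intro m n h
  refine one_div_lt_one_div_of_lt (mul_pos (nthPrime_pos m) (nthPrime_pos (m + 2))) ?_
  have h1 := nthPrime_strictMono h
  have h2 := nthPrime_strictMono (Nat.add_lt_add_right h 2)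
  exact_mod_cast Nat.mul_lt_mul'' h1 h2

theorem gapAtom_mem_integralAt {k n : ℕ} (h : k ≠ n) (h' : k + 2 ≠ n) :
    gapAtom k ∈ integralAt n := by
  rw [gapAtom, ← Nat.cast_mul]
  refine one_div_mem_integralAt fun hd => ?_
  rcases (nthPrime_prime n).dvd_mul.mp hd with hd | hd
  · exact h (nthPrime_dvd_nthPrime_iff.mp hd).symm
  · exact h' (nthPrime_dvd_nthPrime_iff.mp hd).symm

theorem nsmul_gapAtom_left (n : ℕ) : nthPrime (n + 2) • gapAtom n = 1 / (nthPrime n : ℚ) := by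
  have h1 := (nthPrime_pos n).ne'
  have h2 := (nthPrime_pos (n + 2)).ne'
  rw [gapAtom, nsmul_eq_mul]
  field_simp

theorem nsmul_gapAtom_right (n : ℕ) : nthPrime n • gapAtom n = 1 / (nthPrime (n + 2) : ℚ) := by
  have h1 := (nthPrime_pos n).ne'
  have h2 := (nthPrime_pos (n + 2)).ne'
  rw [gapAtom, nsmul_eq_mul]
  field_simp

/-- The element of `primeGapMonoid` with multiplicities `c`. -/
noncomputable def gapSum : (ℕ →₀ ℕ) →ₗ[ℕ] ℚ := Finsupp.linearCombination ℕ gapAtom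

theorem gapSum_single (n m : ℕ) : gapSum (Finsupp.single n m) = m • gapAtom n :=
  Finsupp.linearCombination_single ℕ m n

theorem gapSum_apply (c : ℕ →₀ ℕ) : gapSum c = ∑ k ∈ c.support, c k • gapAtom k := rfl

theorem gapAtom_mem (n : ℕ) : gapAtom n ∈ primeGapMonoid :=
  AddSubmonoid.subset_closure ⟨n, rfl⟩

theorem gapSum_mem (c : ℕ →₀ ℕ) : gapSum c ∈ primeGapMonoid := by
  rw [gapSum_apply]
  exact sum_mem fun k _ => nsmul_mem (gapAtom_mem k) _

theorem exists_gapSum_eq {x : ℚ} (hx : x ∈ primeGapMonoid) : ∃ c, gapSum c = x := by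
  induction hx using AddSubmonoid.closure_induction with
  | mem x hx =>
    obtain ⟨n, rfl⟩ := hx
    exact ⟨Finsupp.single n 1, by rw [gapSum_single, one_nsmul]; rfl⟩
  | zero => exact ⟨0, map_zero _⟩
  | add x y _ _ hx hy =>
    obtain ⟨c, rfl⟩ := hx
    obtain ⟨d, rfl⟩ := hy
    exact ⟨c + d, map_add _ _ _⟩

theorem one_div_nthPrime_mem (n : ℕ) : 1 / (nthPrime n : ℚ) ∈ primeGapMonoid :=
  nsmul_gapAtom_left n ▸ nsmul_mem (gapAtom_mem n) _

theorem nonneg_of_mem_primeGapMonoid {x : ℚ} (hx : x ∈ primeGapMonoid) : 0 ≤ x := by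
  obtain ⟨c, rfl⟩ := exists_gapSum_eq hx
  rw [gapSum_apply]
  exact Finset.sum_nonneg fun k _ => nsmul_nonneg (gapAtom_pos k).le _

theorem gapSum_eq_add_erase (c : ℕ →₀ ℕ) (k : ℕ) :
    gapSum c = c k • gapAtom k + gapSum (c.erase k) := by
  conv_lhs => rw [← Finsupp.single_add_erase k c]
  rw [map_add, gapSum_single]

theorem gapAtom_le_gapSum {c : ℕ →₀ ℕ} {k : ℕ} (h : c k ≠ 0) : gapAtom k ≤ gapSum c := by
  rw [gapSum_eq_add_erase c k]
  have h1 := nonneg_of_mem_primeGapMonoid (gapSum_mem (c.erase k))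
  have h2 : gapAtom k ≤ c k • gapAtom k := le_self_nsmul (gapAtom_pos k).le h
  linarith

theorem gapSum_mem_integralAt {c : ℕ →₀ ℕ} {n : ℕ} (h : ∀ k, c k ≠ 0 → k ≠ n ∧ k + 2 ≠ n) :
    gapSum c ∈ integralAt n := by
  rw [gapSum_apply]
  refine sum_mem fun k hk => nsmul_mem ?_ _
  have := h k (Finsupp.mem_support_iff.mp hk)
  exact gapAtom_mem_integralAt this.1 this.2

theorem eq_zero_of_gapSum_eq_zero {c : ℕ →₀ ℕ} (h : gapSum c = 0) : c = 0 := by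
  ext k
  by_contra hk
  exact absurd (gapAtom_le_gapSum hk) (by rw [h]; exact not_le.mpr (gapAtom_pos k))

theorem primeGapMonoid_eq_zero_of_isAddUnit {x : primeGapMonoid} (hx : IsAddUnit x) : x = 0 := by
  obtain ⟨y, hy⟩ := hx.exists_neg
  have h : x.1 + y.1 = 0 := congrArg Subtype.val hy
  exact Subtype.ext ((add_eq_zero_iff_of_nonneg (nonneg_of_mem_primeGapMonoid x.2)
    (nonneg_of_mem_primeGapMonoid y.2)).mp h).1

/-- Generators decrease in size, so only indices `≥ n` can occur. Among these only `n` itself brings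
the prime `nthPrime n` into the denominator, so it occurs, and it already exhausts the sum. -/
theorem eq_single_of_gapSum_eq_gapAtom {c : ℕ →₀ ℕ} {n : ℕ} (h : gapSum c = gapAtom n) :
    c = Finsupp.single n 1 := by
  have hle : ∀ k, c k ≠ 0 → n ≤ k := fun k hk =>
    gapAtom_strictAnti.le_iff_ge.mp (h ▸ gapAtom_le_gapSum hk)
  have hn : c n ≠ 0 := by
    intro hn
    have h1 : gapSum c ∈ integralAt n := gapSum_mem_integralAt fun k hk => by
      have := hle k hk
      have : k ≠ n := fun hkn => hk (hkn ▸ hn)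
      omega
    rw [h] at h1
    have h2 := nsmul_mem h1 (nthPrime (n + 2))
    rw [nsmul_gapAtom_left] at h2
    have h3 := dvd_of_div_mem_integralAt (n := n) (t := 1) (by exact_mod_cast h2)
    exact (nthPrime_prime n).one_lt.ne' (Nat.dvd_one.mp h3)
  have h1 : c = Finsupp.single n 1 + (c - Finsupp.single n 1) := by
    ext k
    by_cases hk : n = k
    · subst hk
      simp
      omega
    · simp [hk]
  rw [h1, map_add, gapSum_single, one_nsmul, add_eq_left] at h
  rw [h1, eq_zero_of_gapSum_eq_zero h, add_zero]

theorem addIrreducible_gapAtom (n : ℕ) :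
    AddIrreducible (⟨gapAtom n, gapAtom_mem n⟩ : primeGapMonoid) := by
  refine ⟨fun h => ?_, fun x y hxy => ?_⟩
  · exact (gapAtom_pos n).ne' (congrArg Subtype.val (primeGapMonoid_eq_zero_of_isAddUnit h))
  · obtain ⟨c, hc⟩ := exists_gapSum_eq x.2
    obtain ⟨d, hd⟩ := exists_gapSum_eq y.2
    have h : gapAtom n = x.1 + y.1 := congrArg Subtype.val hxy
    have hcd : c + d = Finsupp.single n 1 :=
      eq_single_of_gapSum_eq_gapAtom (by rw [map_add, hc, hd, h])
    have key : ∀ {z : primeGapMonoid} {e : ℕ →₀ ℕ}, gapSum e = z.1 → (∀ k, e k = 0) →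
        IsAddUnit z := fun {z e} hz he => by
      have h0 : z = 0 := Subtype.ext (by rw [← hz, Finsupp.ext (g := 0) he, map_zero]; rfl)
      rw [h0]
      exact isAddUnit_zero
    have hk : ∀ k, c k + d k = if n = k then 1 else 0 := fun k => by
      rw [← Finsupp.add_apply, hcd, Finsupp.single_apply]
    have hn := hk n
    rw [if_pos rfl] at hn
    rcases Nat.eq_zero_or_pos (c n) with h0 | h0
    · refine Or.inl (key hc fun k => ?_)
      have := hk k
      split_ifs at this with hnk
      · exact hnk ▸ h0
      · omega
    · refine Or.inr (key hd fun k => ?_)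
      have := hk k
      split_ifs at this with hnk
      · subst hnk
        omega
      · omega

theorem isAtomicMonoid_primeGapMonoid : IsAtomicMonoid primeGapMonoid := by
  intro b _
  obtain ⟨c, hc⟩ := exists_gapSum_eq b.2
  have hb : b = ∑ k ∈ c.support, c k • (⟨gapAtom k, gapAtom_mem k⟩ : primeGapMonoid) := by
    refine Subtype.ext ?_
    rw [AddSubmonoid.coe_finsetSum, ← hc, gapSum_apply]
    rfl
  rw [hb]
  exact sum_mem fun k _ =>
    nsmul_mem (AddSubmonoid.subset_closure (addIrreducible_gapAtom k)) _

/-! ### Existence of maximal common divisors. -/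

/-- Carrying down the progression `N, N + 2, …`: integrality at the top prime forces the highest
remaining generator, together with the incoming term `t / p`, to collapse to a multiple of the
reciprocal of the next lower prime. The last disjunction keeps the final multiple of `1 / nthPrime
N` positive. -/
theorem gapSum_add_div_sub_mem (N J : ℕ) : ∀ (c : ℕ →₀ ℕ) (t : ℕ),
    (∀ j, J ≤ j → c (N + 2 * j) = 0) →
    (∀ j, gapSum c + t / nthPrime (N + 2 * J) ∈ integralAt (N + 2 * (j + 1))) →
    (0 < t ∨ ∃ j, c (N + 2 * j) ≠ 0) →
    gapSum c + t / nthPrime (N + 2 * J) - 1 / nthPrime N ∈ primeGapMonoid := by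
  induction J with
  | zero =>
    intro c t hc _ h
    have ht : 0 < t := h.resolve_right fun ⟨j, hj⟩ => hj (hc j (Nat.zero_le j))
    obtain ⟨t, rfl⟩ := Nat.exists_eq_add_of_lt ht
    have : gapSum c + ((0 + t + 1 : ℕ) : ℚ) / nthPrime (N + 2 * 0) - 1 / nthPrime N =
        gapSum c + t • (1 / (nthPrime N : ℚ)) := by
      rw [nsmul_eq_mul, show N + 2 * 0 = N from rfl, zero_add, Nat.cast_succ, add_div, mul_one_div,
        ← add_assoc, add_sub_cancel_right]
    rw [this]
    exact add_mem (gapSum_mem c) (nsmul_mem (one_div_nthPrime_mem N) t)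
  | succ J ih =>
    intro c t hc hint h
    have hM : N + 2 * (J + 1) = N + 2 * J + 2 := by ring
    generalize hM' : N + 2 * J = M at *
    have h1 := (nthPrime_pos M).ne'
    have h2 := (nthPrime_pos (M + 2)).ne'
    have hsum : gapSum c + t / nthPrime (N + 2 * (J + 1)) =
        gapSum (c.erase M) + ((c M + t * nthPrime M : ℕ) : ℚ) * gapAtom M := by
      rw [gapSum_eq_add_erase c M, hM, gapAtom, nsmul_eq_mul]
      push_cast
      field_simp
      ring
    -- Only indices `M` and `M + 2` involve the prime of index `M + 2`; the first is erased and the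
    -- second is absent by `hc`.
    have herase : gapSum (c.erase M) ∈ integralAt (M + 2) := by
      refine gapSum_mem_integralAt fun k hk => ⟨?_, ?_⟩
      · rintro rfl
        rw [Finsupp.erase_ne (by omega), ← hM, hc _ le_rfl] at hk
        exact hk rfl
      · intro hkM
        obtain rfl : k = M := by omega
        exact hk Finsupp.erase_same
    have hdvd : nthPrime (M + 2) ∣ c M + t * nthPrime M := by
      have h3 := hint J
      rw [hsum, hM] at h3
      -- Multiplying by `nthPrime M` turns `gapAtom M` into `1 / nthPrime (M + 2)`, so integrality
      -- becomes divisibility.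
      have h4 := nsmul_mem ((AddSubgroup.add_mem_cancel_left _ herase).mp h3) (nthPrime M)
      refine dvd_of_div_mem_integralAt ?_
      convert h4 using 1
      rw [gapAtom, nsmul_eq_mul]
      field_simp
    obtain ⟨t', ht'⟩ := hdvd
    have hsum' : gapSum c + t / nthPrime (N + 2 * (J + 1)) =
        gapSum (c.erase M) + t' / nthPrime M := by
      rw [hsum, ht', gapAtom]
      push_cast
      field_simp
    rw [hsum'] at hint ⊢
    refine ih (c.erase M) t' (fun j hj => ?_) hint ?_
    · rcases Nat.eq_or_lt_of_le hj with rfl | hj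
      · rw [hM', Finsupp.erase_same]
      · rw [Finsupp.erase_ne (by omega)]
        exact hc j hj
    · have hpos : 0 < c M + t * nthPrime M → 0 < t' := fun h0 => by
        rw [ht'] at h0
        exact Nat.pos_of_mul_pos_left h0
      rcases h with h | ⟨j, hj⟩
      · exact Or.inl (hpos (Nat.add_pos_right _ (Nat.mul_pos h (nthPrime_prime M).pos)))
      · by_cases hjM : N + 2 * j = M
        · exact Or.inl (hpos (Nat.add_pos_left (Nat.pos_of_ne_zero (hjM ▸ hj)) _))
        · exact Or.inr ⟨j, by rwa [Finsupp.erase_ne hjM]⟩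

/-- If `gapSum c` involves a generator of index `N + 2 * j` but its denominator involves none of the
primes of index `N + 2, N + 4, …`, then it is divisible by `1 / nthPrime N`. -/
theorem gapSum_sub_mem {N : ℕ} {c : ℕ →₀ ℕ} (hint : ∀ j, gapSum c ∈ integralAt (N + 2 * (j + 1)))
    (h : ∃ j, c (N + 2 * j) ≠ 0) : gapSum c - 1 / nthPrime N ∈ primeGapMonoid := by
  have hJ : ∀ j, c.support.sup id + 1 ≤ j → c (N + 2 * j) = 0 := fun j hj => by
    by_contra h0
    have : N + 2 * j ≤ c.support.sup id :=
      Finset.le_sup (f := id) (Finsupp.mem_support_iff.mpr h0)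
    omega
  have := gapSum_add_div_sub_mem N _ c 0 hJ
  simp only [Nat.cast_zero, zero_div, add_zero] at this
  exact this hint (Or.inr h)

/-- Take a common divisor in `D` that exceeds the largest possible multiple of `ε`. Adding some `e ≥
ε` would reach the next multiple; the multiples are bounded because `d ≤ b`. -/
theorem exists_maximal_common_divisor_of_le {D : AddSubmonoid ℚ} (b c : primeGapMonoid) {ε : ℚ}
    (hε : 0 < ε) : ∃ d ∈ D, b - d ∈ primeGapMonoid ∧ c - d ∈ primeGapMonoid ∧
      ∀ e ∈ D, ε ≤ e → b - d - e ∈ primeGapMonoid → c - d - e ∉ primeGapMonoid := by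
  classical
  let p : ℕ → Prop := fun n =>
    ∃ d ∈ D, b - d ∈ primeGapMonoid ∧ c - d ∈ primeGapMonoid ∧ n * ε ≤ d
  have hbound : ∀ n, p n → n ≤ ⌊b / ε⌋₊ := by
    rintro n ⟨d, -, hb, -, hn⟩
    have h1 := nonneg_of_mem_primeGapMonoid hb
    refine Nat.le_floor ?_
    rw [le_div_iff₀ hε]
    linarith
  have h0 : p 0 := ⟨0, zero_mem D, by simp, by simp, by simp⟩
  obtain ⟨d, hd, hb, hc, hn⟩ := Nat.findGreatest_spec (Nat.zero_le ⌊b / ε⌋₊) h0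
  refine ⟨d, hd, hb, hc, fun e he hεe hbe hce => ?_⟩
  have h1 : p (Nat.findGreatest p ⌊b / ε⌋₊ + 1) := by
    refine ⟨d + e, add_mem hd he, by rwa [← sub_sub], by rwa [← sub_sub], ?_⟩
    push_cast
    linarith
  have h2 := Nat.le_findGreatest (hbound _ h1) h1
  omega

theorem exists_maximal_common_divisor_primeGapMonoid (b c : primeGapMonoid) :
    ∃ d ∈ primeGapMonoid, b - d ∈ primeGapMonoid ∧ c - d ∈ primeGapMonoid ∧
      ∀ e ∈ primeGapMonoid, b - d - e ∈ primeGapMonoid → c - d - e ∈ primeGapMonoid → e = 0 := by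
  obtain ⟨N₁, hN₁⟩ := exists_forall_mem_integralAt b
  obtain ⟨N₂, hN₂⟩ := exists_forall_mem_integralAt c
  obtain ⟨N, hN₁', hN₂'⟩ : ∃ N, N₁ ≤ N ∧ N₂ ≤ N := ⟨max N₁ N₂, le_max_left _ _, le_max_right _ _⟩
  -- One reciprocal for each parity of index; subtracting them does not affect integrality at primes
  -- of index `≥ N + 2`.
  let D : AddSubmonoid ℚ :=
    AddSubmonoid.closure {1 / (nthPrime N : ℚ), 1 / (nthPrime (N + 1) : ℚ)}
  have hD : D ≤ primeGapMonoid := by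
    rw [AddSubmonoid.closure_le]
    rintro x (rfl | rfl) <;> exact one_div_nthPrime_mem _
  have hDint : ∀ n, N + 2 ≤ n → ∀ d ∈ D, d ∈ integralAt n := by
    intro n hn
    change D ≤ (integralAt n).toAddSubmonoid
    rw [AddSubmonoid.closure_le]
    rintro x (rfl | rfl) <;> refine one_div_mem_integralAt fun h => ?_ <;>
    · have := nthPrime_dvd_nthPrime_iff.mp h
      omega
  obtain ⟨d₁, hd₁, hb₁, hc₁, hmax₁⟩ := exists_maximal_common_divisor_of_le (D := D) b c
    (one_div_pos.mpr (nthPrime_pos (N + 1)))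
  have hdiv : ∀ M, 1 / (nthPrime M : ℚ) ∈ D → N ≤ M → M ≤ N + 1 → ∀ f : ℕ →₀ ℕ,
      b - d₁ - gapSum f ∈ primeGapMonoid → c - d₁ - gapSum f ∈ primeGapMonoid →
      ∀ j, f (M + 2 * j) = 0 := by
    intro M hMD hNM hMN f hbf hcf j
    by_contra hj
    have key : ∀ x : ℚ, (∀ n, N ≤ n → x ∈ integralAt n) → x - d₁ - gapSum f ∈ primeGapMonoid →
        x - d₁ - 1 / nthPrime M ∈ primeGapMonoid := by
      intro x hx hxf
      obtain ⟨g, hg⟩ := exists_gapSum_eq hxf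
      have hfg : gapSum (f + g) = x - d₁ := by
        rw [map_add, hg]
        ring
      rw [← hfg]
      refine gapSum_sub_mem (fun i => ?_) ⟨j, ?_⟩
      · rw [hfg]
        exact sub_mem (hx _ (by omega)) (hDint _ (by omega) _ hd₁)
      · rw [Finsupp.add_apply]
        omega
    refine hmax₁ _ hMD ?_ (key b (fun n hn => hN₁ n (hN₁'.trans hn)) hbf)
      (key c (fun n hn => hN₂ n (hN₂'.trans hn)) hcf)
    refine one_div_le_one_div_of_le (nthPrime_pos M) ?_
    exact_mod_cast nthPrime_strictMono.monotone hMN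
  -- By `hdiv` only generators of index `< N` survive in a common divisor, and these exceed `gapAtom
  -- N`.
  have hlarge : ∀ e ∈ primeGapMonoid, e ≠ 0 → b - d₁ - e ∈ primeGapMonoid →
      c - d₁ - e ∈ primeGapMonoid → gapAtom N ≤ e := by
    intro e he he0 hbe hce
    obtain ⟨f, rfl⟩ := exists_gapSum_eq he
    have hf : f ≠ 0 := fun h => he0 (by rw [h, map_zero])
    obtain ⟨k, hk⟩ := Finsupp.ne_iff.mp hf
    rw [Finsupp.zero_apply] at hk
    have hkN : k < N := by
      by_contra hkN
      push Not at hkN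
      rcases Nat.even_or_odd' (k - N) with ⟨j, hj | hj⟩
      · obtain rfl : k = N + 2 * j := by omega
        exact hk (hdiv N (AddSubmonoid.subset_closure (Or.inl rfl)) le_rfl (Nat.le_succ N) f
          hbe hce j)
      · obtain rfl : k = N + 1 + 2 * j := by omega
        exact hk (hdiv (N + 1) (AddSubmonoid.subset_closure (Or.inr rfl)) (Nat.le_succ N) le_rfl f
          hbe hce j)
    exact (gapAtom_strictAnti hkN).le.trans (gapAtom_le_gapSum hk)
  obtain ⟨d₂, hd₂, hb₂, hc₂, hmax₂⟩ := exists_maximal_common_divisor_of_le (D := primeGapMonoid)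
    ⟨_, hb₁⟩ ⟨_, hc₁⟩ (gapAtom_pos N)
  refine ⟨d₁ + d₂, add_mem (hD hd₁) hd₂, by rwa [← sub_sub], by rwa [← sub_sub],
    fun e he hbe hce => ?_⟩
  rw [← sub_sub] at hbe hce
  by_contra he0
  refine hmax₂ e he (hlarge e he he0 ?_ ?_) hbe hce
  -- A divisor of what is left after `d₂` also divides what was left after `d₁`.
  · convert add_mem hbe hd₂ using 1
    ring
  · convert add_mem hce hd₂ using 1
    ring

theorem isStronglyAtomic_primeGapMonoid : IsStronglyAtomic primeGapMonoid := by
  refine isAtomicMonoid_primeGapMonoid.isStronglyAtomic_of_maximal_common_divisor fun b c => ?_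
  obtain ⟨d, hd, hb, hc, hmax⟩ := exists_maximal_common_divisor_primeGapMonoid b c
  refine ⟨⟨d, hd⟩, ⟨_, hb⟩, ⟨_, hc⟩, Subtype.ext (add_sub_cancel _ _).symm,
    Subtype.ext (add_sub_cancel _ _).symm, ?_⟩
  rintro ⟨e, he⟩ ⟨y, hy⟩ ⟨z, hz⟩
  have hy' : b - d = e + y := congrArg Subtype.val hy
  have hz' : c - d = e + z := congrArg Subtype.val hz
  obtain rfl := hmax e he (by rw [hy', add_sub_cancel_left]; exact y.2)
    (by rw [hz', add_sub_cancel_left]; exact z.2)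
  exact isAddUnit_zero

/-! ### Failure of weak-ACCP. -/

/-- The part `w` with indices of the wrong parity is integral at primes of the parity of `i` by its
generators, and at the others because it is `1 / nthPrime i` minus the other part. So it is an
integer in `[0, 1)`, namely `0`. -/
theorem apply_eq_zero_of_gapSum_eq_one_div {f : ℕ →₀ ℕ} {i : ℕ}
    (h : gapSum f = 1 / nthPrime i) {k : ℕ} (hk : k % 2 ≠ i % 2) : f k = 0 := by
  classical
  set u := f.filter fun k => k % 2 = i % 2
  set w := f.filter fun k => ¬ k % 2 = i % 2
  have huw : gapSum u + gapSum w = 1 / nthPrime i := by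
    rw [← map_add, Finsupp.filter_add_filter_not, h]
  have hu : ∀ k, u k ≠ 0 → k % 2 = i % 2 := fun k hk => by
    by_contra h0
    exact hk (Finsupp.filter_apply_neg _ _ h0)
  have hw : ∀ k, w k ≠ 0 → k % 2 ≠ i % 2 := fun k hk h0 =>
    hk (Finsupp.filter_apply_neg _ _ (not_not.mpr h0))
  have hint : ∀ n, gapSum w ∈ integralAt n := by
    intro n
    by_cases hn : n % 2 = i % 2
    · refine gapSum_mem_integralAt fun k hk => ?_
      have := hw k hk
      omega
    · rw [eq_sub_of_add_eq' huw]
      refine sub_mem (one_div_mem_integralAt fun hd => ?_) (gapSum_mem_integralAt fun k hk => ?_)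
      · exact hn (by rw [nthPrime_dvd_nthPrime_iff.mp hd])
      · have := hu k hk
        omega
  have hden := den_eq_one_of_forall_mem_integralAt hint
  have hw0 := nonneg_of_mem_primeGapMonoid (gapSum_mem w)
  have hu0 := nonneg_of_mem_primeGapMonoid (gapSum_mem u)
  have hw1 : gapSum w < 1 := by
    have : 1 / (nthPrime i : ℚ) < 1 := by
      rw [div_lt_one (nthPrime_pos i)]
      exact_mod_cast (nthPrime_prime i).one_lt
    linarith
  have hnum : ((gapSum w).num : ℚ) = gapSum w := Rat.den_eq_one_iff _ |>.mp hden
  have hnum0 : (gapSum w).num = 0 := by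
    have h1 : (gapSum w).num < 1 := by
      rw [← hnum] at hw1
      exact_mod_cast hw1
    have h2 := Rat.num_nonneg.mpr hw0
    omega
  have hwz := eq_zero_of_gapSum_eq_zero (Rat.num_eq_zero.mp hnum0)
  have hwk : w k = f k := Finsupp.filter_apply_pos _ _ hk
  rw [← hwk, hwz, Finsupp.zero_apply]

/-- The reciprocals along `i, i + 2, …` form a strict chain: `nthPrime (m + 2)` copies of `gapAtom
m` make `1 / nthPrime m`, and only `nthPrime m` copies make `1 / nthPrime (m + 2)`. -/
theorem not_satisfiesACCP_one_div (i : ℕ) :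
    ¬ SatisfiesACCP (⟨1 / nthPrime i, one_div_nthPrime_mem i⟩ : primeGapMonoid) := by
  intro h
  let x : ℕ → primeGapMonoid := fun n =>
    ⟨1 / nthPrime (i + 2 * n), one_div_nthPrime_mem (i + 2 * n)⟩
  obtain ⟨n, y, hy⟩ := SatisfiesACCP.exists_divides_succ (x := x) h fun n => by
    let m := i + 2 * n
    have hlt : nthPrime m < nthPrime (m + 2) := nthPrime_strictMono (by omega)
    refine ⟨⟨_, nsmul_mem (gapAtom_mem m) (nthPrime (m + 2) - nthPrime m)⟩, Subtype.ext ?_⟩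
    change 1 / (nthPrime m : ℚ) = 1 / (nthPrime (m + 2) : ℚ) + _
    rw [← nsmul_gapAtom_left, ← nsmul_gapAtom_right, ← add_nsmul, Nat.add_sub_cancel' hlt.le]
  have h1 : 1 / (nthPrime (i + 2 * (n + 1)) : ℚ) = 1 / nthPrime (i + 2 * n) + y :=
    congrArg Subtype.val hy
  have h2 : 1 / (nthPrime (i + 2 * (n + 1)) : ℚ) < 1 / nthPrime (i + 2 * n) :=
    one_div_lt_one_div_of_lt (nthPrime_pos _)
      (by exact_mod_cast nthPrime_strictMono (by omega))
  have h3 := nonneg_of_mem_primeGapMonoid y.2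
  linarith

theorem not_isWeakACCP_primeGapMonoid : ¬ IsWeakACCP primeGapMonoid := by
  classical
  rintro ⟨-, h⟩
  let x : ℕ → primeGapMonoid := fun i => ⟨1 / nthPrime i, one_div_nthPrime_mem i⟩
  obtain ⟨d, hd, s, hs, c, hsc, hc⟩ := h {x 0, x 1} (Finset.insert_nonempty _ _)
  obtain ⟨f, hf⟩ := exists_gapSum_eq d.2
  have key : ∀ i, Divides d (x i) → ∀ k, k % 2 ≠ i % 2 → f k = 0 := by
    rintro i ⟨y, hy⟩ k hk
    obtain ⟨g, hg⟩ := exists_gapSum_eq y.2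
    have hfg : gapSum (f + g) = 1 / nthPrime i := by
      rw [map_add, hf, hg]
      exact (congrArg Subtype.val hy).symm
    have := apply_eq_zero_of_gapSum_eq_one_div hfg hk
    rw [Finsupp.add_apply] at this
    omega
  -- Dividing `x 0` excludes odd indices and dividing `x 1` excludes even ones.
  have hf0 : f = 0 := by
    ext k
    rcases Nat.mod_two_eq_zero_or_one k with hk | hk
    · exact key 1 (hd _ (by simp)) k (by omega)
    · exact key 0 (hd _ (by simp)) k (by omega)
  have hd0 : d = 0 := Subtype.ext (by rw [← hf, hf0, map_zero]; rfl)
  rw [hd0, zero_add] at hsc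
  subst hsc
  rw [Finset.mem_insert, Finset.mem_singleton] at hs
  rcases hs with rfl | rfl
  · exact not_satisfiesACCP_one_div 0 hc
  · exact not_satisfiesACCP_one_div 1 hc

end PrimeGapMonoid

end AddFactorization

theorem mainTheorem3 :
    -- the implications, for every commutative cancellative monoid
    (∀ (M : Type*) [AddCancelCommMonoid M],
      (AddFactorization.IsStronglyAtomic M → AddFactorization.IsAtomicMonoid M) ∧
      (AddFactorization.IsWeakACCP M → AddFactorization.IsStronglyAtomic M) ∧
      (AddFactorization.IsACCP M → AddFactorization.IsWeakACCP M)) ∧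
    -- none of them is reversible
    (∃ (M : Type) (_ : AddCancelCommMonoid M),
      AddFactorization.IsWeakACCP M ∧ ¬ AddFactorization.IsACCP M) ∧
    (AddFactorization.IsStronglyAtomic AddFactorization.primeGapMonoid ∧
      ¬ AddFactorization.IsWeakACCP AddFactorization.primeGapMonoid) ∧
    (∃ (M : Type) (_ : AddCancelCommMonoid M),
      AddFactorization.IsAtomicMonoid M ∧ ¬ AddFactorization.IsStronglyAtomic M) := by
  refine ⟨fun M _ => ⟨fun h => h.isAtomicMonoid, fun h => h.isStronglyAtomic,
    fun h => h.isWeakACCP⟩, ⟨AddFactorization.halfCarryMonoid AddFactorization.nonnegRat,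
      inferInstance, ?_, ?_⟩, ⟨?_, ?_⟩,
    ⟨AddFactorization.halfCarryMonoid AddFactorization.openQuadrant, inferInstance, ?_, ?_⟩⟩
  · exact AddFactorization.isWeakACCP_halfCarryMonoid_nonnegRat
  · exact AddFactorization.not_isACCP_halfCarryMonoid_nonnegRat
  · exact AddFactorization.isStronglyAtomic_primeGapMonoid
  · exact AddFactorization.not_isWeakACCP_primeGapMonoid
  · exact AddFactorization.halfCarryMonoid_isAtomicMonoid _ AddFactorization.openQuadrant_reduced
  · exact AddFactorization.not_isStronglyAtomic_halfCarryMonoid_openQuadrant
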